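/- Let $K,m\ge 1$ be integers, $\rho>0$ and $R\ge 0$. Consider a single-antenna (SISO) link over a time slot divided into $K$ equal sub-slots, in which a reconfigurable intelligent surface activates in sub-slot $k$ only its $k$-th sub-surface, consisting of $m$ elements (activate-reflect scheme). Under the central-limit model, the scalar end-to-end channels $\mathcal H_1,\dots,\mathcal H_K$ of the sub-slots are independent circularly symmetric complex Gaussian random variables with mean $0$ and variance $\mathbb E|\mathcal H_k|^2=m$. Then the outage probability at target rate $R$ and average signal-to-noise ratio $\rho$ is $$\mathbb P\Big\{\frac1K\sum_{k=1}^K\log_2\big(1+\rho|\mathcal H_k|^2\big)<R\Big\}=1-\exp\Big(\frac{K}{\rho m}\Big)\,H^{K+1,0}_{1,K+1}\left[\begin{array}{c}(1,1,0)\\(0,1,0),\underbrace{(1,1,\tfrac1{\rho m}),\dots,(1,1,\tfrac1{\rho m})}_{K}\end{array}\Bigg|\,\Theta\right],\qquad \Theta=\Big(\frac{2^R}{\rho m}\Big)^K.$$ Here $H^{\mu,\nu}_{p,q}$ is the generalized upper incomplete Fox H-function $$H^{\mu,\nu}_{p,q}\left[\begin{array}{c}(a_i,\alpha_i,A_i)_{1,p}\\(b_j,\beta_j,B_j)_{1,q}\end{array}\Bigg|\,x\right]=\frac1{2\pi\jmath}\int_{c-\jmath\infty}^{c+\jmath\infty}\frac{\prod_{j=1}^{\mu}\Gamma(b_j+\beta_j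 s,B_j)\prod_{i=1}^{\nu}\Gamma(1-a_i-\alpha_i s,A_i)}{\prod_{i=\nu+1}^{p}\Gamma(a_i+\alpha_i s,A_i)\prod_{j=\mu+1}^{q}\Gamma(1-b_j-\beta_j s,B_j)}\,x^{-s}\,ds,$$ where $\Gamma(s,x)=\int_x^\infty t^{s-1}e^{-t}\,dt$ is the upper incomplete Gamma function, $\Gamma(s,0)=\Gamma(s)$ is (meromorphically continued) Euler's Gamma function, and the line $\operatorname{Re}s=c$ has all poles of the factors $\Gamma(b_j+\beta_js,B_j)$, $j\le\mu$, to its left and all poles of the factors $\Gamma(1-a_i-\alpha_is,A_i)$, $i\le\nu$, to its right. For the parameters above such lines exist, and for each of them the integral converges absolutely and the formula holds. -/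

import Mathlib

open MeasureTheory ProbabilityTheory
open scoped NNReal Matrix

noncomputable section

/-- The circularly symmetric complex Gaussian law `CN(0, v)`: real and imaginary parts are
independent real Gaussians with mean `0` and variance `v / 2`. -/
def complexGaussian (v : ℝ≥0) : Measure ℂ :=
  ((gaussianReal 0 (v / 2)).prod (gaussianReal 0 (v / 2))).map
    Complex.measurableEquivRealProd.symm

/-- Mutual information (bits per channel use) over one time slot with `K` equal sub-slots, when the
end-to-end channel matrix in sub-slot `k` is `H k` (`N` transmit and `L` receive antennas) and the
average SNR is `ρ`:  `(1/K) ∑ₖ log₂ det (I_L + (ρ/N) Hₖ Hₖ†)`.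
The determinant is real, being that of a Hermitian matrix. -/
def mutualInfo {K N L : ℕ} (ρ : ℝ) (H : Fin K → Matrix (Fin L) (Fin N) ℂ) : ℝ :=
  (1 / (K : ℝ)) * ∑ k, Real.logb 2
    (Matrix.det (1 + ((ρ / (N : ℝ) : ℝ) : ℂ) • (H k * (H k)ᴴ))).re

/-- Outage probability: the probability that the mutual information is below the target
rate `R`. -/
def outageProb {Ω : Type*} [MeasurableSpace Ω] (P : Measure Ω) {K N L : ℕ} (ρ R : ℝ)
    (H : Fin K → Ω → Matrix (Fin L) (Fin N) ℂ) : ℝ :=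
  P.real {ω | mutualInfo ρ (fun k => H k ω) < R}

/-- The upper incomplete Gamma function `Γ(s, x) = ∫_x^∞ t^(s-1) e^(-t) dt` for `x ≥ 0`.
For `x > 0` the integral converges for every `s` and is entire in `s`; for `x = 0` it is the
(meromorphically continued) Gamma function. -/
def upperGamma (s : ℂ) (x : ℝ) : ℂ :=
  if x = 0 then Complex.Gamma s
  else ∫ t in Set.Ioi x, (t : ℂ) ^ (s - 1) * (Real.exp (-t) : ℂ)

/-- A parameter triple `(a, α, A)` of the generalized upper incomplete Fox H-function:
offset `a`, slope `α > 0`, and lower limit `A ≥ 0` of the incomplete Gamma function. -/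
structure FoxParam where
  offset : ℂ
  slope : ℝ
  lower : ℝ

/-- The Mellin-Barnes kernel of the generalized upper incomplete Fox H-function `H^{m,n}_{p,q}`:
`∏_{j≤m} Γ(b_j+β_j s, B_j) ∏_{i≤n} Γ(1-a_i-α_i s, A_i)` divided by
`∏_{i>n} Γ(a_i+α_i s, A_i) ∏_{j>m} Γ(1-b_j-β_j s, B_j)`. -/
def foxKernel (m n : ℕ) {p q : ℕ} (a : Fin p → FoxParam) (b : Fin q → FoxParam) (s : ℂ) : ℂ :=
  (∏ j : Fin q,
    if (j : ℕ) < m then upperGamma ((b j).offset + (b j).slope * s) (b j).lower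
    else (upperGamma (1 - (b j).offset - (b j).slope * s) (b j).lower)⁻¹) *
  (∏ i : Fin p,
    if (i : ℕ) < n then upperGamma (1 - (a i).offset - (a i).slope * s) (a i).lower
    else (upperGamma ((a i).offset + (a i).slope * s) (a i).lower)⁻¹)

/-- The vertical line `Re s = c` is a Mellin-Barnes contour for `H^{m,n}_{p,q}`: all poles of the
factors `Γ(b_j+β_j s, B_j)`, `j ≤ m`, lie strictly to its left, and all poles of the factors
`Γ(1-a_i-α_i s, A_i)`, `i ≤ n`, strictly to its right. A factor `Γ(·, x)` has poles only if
`x = 0`, and then exactly where its first argument is a non-positive integer. -/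
def IsFoxContour (m n : ℕ) {p q : ℕ} (a : Fin p → FoxParam) (b : Fin q → FoxParam)
    (c : ℝ) : Prop :=
  (∀ j : Fin q, (j : ℕ) < m → (b j).lower = 0 →
    ∀ (l : ℕ) (s : ℂ), (b j).offset + (b j).slope * s = -(l : ℂ) → s.re < c) ∧
  (∀ i : Fin p, (i : ℕ) < n → (a i).lower = 0 →
    ∀ (l : ℕ) (s : ℂ), 1 - (a i).offset - (a i).slope * s = -(l : ℂ) → c < s.re)

/-- The generalized upper incomplete Fox H-function computed along the line `Re s = c`:
`(1/(2πi)) ∫_{c-i∞}^{c+i∞} foxKernel(s) x^(-s) ds`. -/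
def upperIncFoxH (m n : ℕ) {p q : ℕ} (a : Fin p → FoxParam) (b : Fin q → FoxParam)
    (c x : ℝ) : ℂ :=
  mellinInv c (foxKernel m n a b) x

/-- The single upper parameter `(1, 1, 0)`. -/
def outageUpper : Fin 1 → FoxParam := fun _ => ⟨1, 1, 0⟩

/-- The `K + 1` lower parameters `(0, 1, 0), (1, 1, A), …, (1, 1, A)`. -/
def outageLower (K : ℕ) (A : ℝ) : Fin (K + 1) → FoxParam :=
  Fin.cons ⟨0, 1, 0⟩ (fun _ : Fin K => ⟨1, 1, A⟩)

end

/-- The law of `A + X` for a standard exponential variable `X`. -/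
noncomputable def shiftedExp (A : ℝ) : Measure ℝ :=
  (volume.restrict (Set.Ioi A)).withDensity fun t => ENNReal.ofReal (Real.exp (A - t))

theorem lintegral_complexGaussian {v : ℝ≥0} (hv : v ≠ 0) {g : ℂ → ENNReal} (hg : Measurable g) :
    ∫⁻ z, g z ∂complexGaussian v =
      ∫⁻ z, ENNReal.ofReal ((Real.pi * v)⁻¹ * Real.exp (-(‖z‖ ^ 2 / v))) * g z := by
  have hv2 : v / 2 ≠ 0 := by simpa using hv
  have hv0 : (0 : ℝ) < v := by positivity
  rw [complexGaussian, lintegral_map hg (MeasurableEquiv.measurable _),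
    gaussianReal_of_var_ne_zero _ hv2,
    prod_withDensity (measurable_gaussianPDF _ _) (measurable_gaussianPDF _ _),
    lintegral_withDensity_eq_lintegral_mul _ (by fun_prop)
      (show Measurable fun p => g (Complex.measurableEquivRealProd.symm p) from
        hg.comp (MeasurableEquiv.measurable _)),
    ← Complex.volume_preserving_equiv_real_prod.symm.lintegral_comp_emb
      Complex.measurableEquivRealProd.symm.measurableEmbedding]
  refine lintegral_congr fun p => ?_
  simp only [Pi.mul_apply]
  congr 1
  rw [gaussianPDF, gaussianPDF, ← ENNReal.ofReal_mul (gaussianPDFReal_nonneg _ _ _)]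
  congr 1
  have hn : ‖Complex.measurableEquivRealProd.symm p‖ ^ 2 = p.1 ^ 2 + p.2 ^ 2 := by
    rw [← Complex.normSq_eq_norm_sq, Complex.normSq_apply]
    simp [Complex.measurableEquivRealProd, pow_two]
  rw [hn, gaussianPDFReal, gaussianPDFReal, mul_mul_mul_comm, ← mul_inv, ← Real.exp_add,
    Real.mul_self_sqrt (by positivity)]
  push_cast
  congr 2
  · field_simp
  · field_simp
    ring

theorem map_complexGaussian_add_norm_sq {v : ℝ≥0} (hv : v ≠ 0) (A : ℝ) :
    (complexGaussian v).map (fun z => A + ‖z‖ ^ 2 / v) = shiftedExp A := by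
  have hv0 : (0 : ℝ) < v := by positivity
  refine Measure.ext_of_lintegral _ fun g hg => ?_
  rw [lintegral_map hg (by fun_prop), lintegral_complexGaussian hv (by fun_prop),
    ← Complex.lintegral_comp_polarCoord_symm, shiftedExp,
    lintegral_withDensity_eq_lintegral_mul _ (by fun_prop) hg, polarCoord_target,
    Measure.volume_eq_prod, ← Measure.prod_restrict]
  have himg : (fun r : ℝ => A + r ^ 2 / v) '' Set.Ioi 0 = Set.Ioi A := by
    ext t
    simp only [Set.mem_image, Set.mem_Ioi]
    constructor
    · rintro ⟨r, hr, rfl⟩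
      have : 0 < r ^ 2 / v := by positivity
      linarith
    · intro ht
      refine ⟨√(v * (t - A)), Real.sqrt_pos.2 (mul_pos hv0 (by linarith)), ?_⟩
      rw [Real.sq_sqrt (mul_pos hv0 (by linarith)).le]
      field_simp
      ring
  have hinj : Set.InjOn (fun r : ℝ => A + r ^ 2 / v) (Set.Ioi 0) := by
    intro a ha b hb h
    have h2 : a ^ 2 = b ^ 2 := by
      have : a ^ 2 / v = b ^ 2 / v := by simpa using h
      field_simp at this
      exact this
    exact (pow_left_inj₀ (le_of_lt ha) (le_of_lt hb) two_ne_zero).1 h2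
  rw [← himg, lintegral_image_eq_lintegral_abs_deriv_mul measurableSet_Ioi
    (f' := fun r => 2 * r / v) (fun r _ => by
      have := (((hasDerivAt_id r).pow 2).div_const (v : ℝ)).const_add A
      simpa using this.hasDerivWithinAt) hinj,
    lintegral_prod _ (by
      simp only [Complex.polarCoord_symm_apply]
      fun_prop)]
  refine setLIntegral_congr_fun measurableSet_Ioi fun r hr => ?_
  have hr0 : 0 < r := hr
  simp only [Complex.norm_polarCoord_symm, sq_abs, smul_eq_mul, Pi.mul_apply]
  rw [setLIntegral_const, Real.volume_Ioo, abs_of_pos (by positivity), ← mul_assoc, ← mul_assoc,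
    ← ENNReal.ofReal_mul hr0.le, ← ENNReal.ofReal_mul (by positivity), mul_right_comm,
    ← ENNReal.ofReal_mul (by positivity)]
  congr 2
  have hpi := Real.pi_ne_zero
  rw [show A - (A + r ^ 2 / v) = -(r ^ 2 / v) by ring]
  field_simp
  ring

theorem integrable_shiftedExp_iff {E : Type*} [NormedAddCommGroup E] [NormedSpace ℝ E] {A : ℝ}
    {g : ℝ → E} : Integrable g (shiftedExp A) ↔
      IntegrableOn (fun t => Real.exp (A - t) • g t) (Set.Ioi A) := by
  rw [shiftedExp, integrable_withDensity_iff_integrable_smul' (by fun_prop) (by simp)]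
  simp [IntegrableOn, ENNReal.toReal_ofReal (Real.exp_pos _).le]

theorem integral_shiftedExp {E : Type*} [NormedAddCommGroup E] [NormedSpace ℝ E] (A : ℝ)
    (g : ℝ → E) : ∫ t, g t ∂shiftedExp A = ∫ t in Set.Ioi A, Real.exp (A - t) • g t := by
  rw [shiftedExp, integral_withDensity_eq_integral_toReal_smul (by fun_prop) (by simp)]
  simp [ENNReal.toReal_ofReal (Real.exp_pos _).le]

theorem integrableOn_rpow_mul_exp_neg {A c : ℝ} (hA : 0 < A) (hc : 0 < c) :
    IntegrableOn (fun t => t ^ c * Real.exp (-t)) (Set.Ioi A) := by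
  have := (Real.GammaIntegral_convergent (s := c + 1) (by linarith)).mono_set
    (Set.Ioi_subset_Ioi hA.le)
  refine this.congr_fun (fun t _ => ?_) measurableSet_Ioi
  simp [mul_comm]

theorem integrable_rpow_shiftedExp {A c : ℝ} (hA : 0 < A) (hc : 0 < c) :
    Integrable (fun t => t ^ c) (shiftedExp A) := by
  rw [integrable_shiftedExp_iff]
  refine IntegrableOn.congr_fun
    (Integrable.const_mul (integrableOn_rpow_mul_exp_neg hA hc) (Real.exp A))
    (fun t _ => ?_) measurableSet_Ioi
  simp only [smul_eq_mul, sub_eq_add_neg, Real.exp_add]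
  ring

theorem integral_cpow_shiftedExp {A : ℝ} (hA : 0 < A) (s : ℂ) :
    ∫ t, (t : ℂ) ^ s ∂shiftedExp A = (Real.exp A : ℂ) * upperGamma (1 + s) A := by
  rw [integral_shiftedExp, upperGamma, if_neg hA.ne', ← integral_const_mul]
  refine setIntegral_congr_fun measurableSet_Ioi fun t _ => ?_
  simp only [Complex.real_smul, sub_eq_add_neg, Real.exp_add, Complex.ofReal_mul]
  ring_nf

instance (A : ℝ) : NullSingletonClass (shiftedExp A) := by
  unfold shiftedExp; infer_instance

theorem ae_lt_shiftedExp (A : ℝ) : ∀ᵐ t ∂shiftedExp A, A < t :=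
  (withDensity_absolutelyContinuous _ _).ae_le (ae_restrict_mem measurableSet_Ioi)

theorem continuousAt_measureReal_Ioi (μ : Measure ℝ) [IsProbabilityMeasure μ] {x : ℝ}
    (hx : μ {x} = 0) : ContinuousAt (fun y => μ.real (Set.Ioi y)) x := by
  have h1 : (fun y => μ.real (Set.Ioi y)) = fun y => 1 - cdf μ y := by
    funext y
    rw [cdf_eq_real, ← Set.compl_Iic, probReal_compl_eq_one_sub measurableSet_Iic]
  rw [h1]
  refine continuousAt_const.sub ?_
  rw [(cdf μ).mono.continuousAt_iff_leftLim_eq_rightLim, StieltjesFunction.rightLim_eq]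
  have h2 := (cdf μ).measure_singleton x
  rw [measure_cdf, hx, eq_comm, ENNReal.ofReal_eq_zero] at h2
  exact le_antisymm ((cdf μ).mono.leftLim_le le_rfl) (by linarith)

theorem integral_Ioi_zero_indicator_cpow {s : ℂ} (hs : 0 < s.re) {t : ℝ} (ht : 0 < t) :
    ∫ x in Set.Ioi (0 : ℝ), (Set.Iio t).indicator (fun x => (x : ℂ) ^ (s - 1)) x =
      (t : ℂ) ^ s / s := by
  have hs0 : s ≠ 0 := by rintro rfl; simp at hs
  rw [setIntegral_indicator measurableSet_Iio, Set.Ioi_inter_Iio,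
    ← integral_Ioc_eq_integral_Ioo, ← intervalIntegral.integral_of_le ht.le,
    integral_cpow (by left; simpa using hs)]
  simp [Complex.zero_cpow hs0]

theorem integrableOn_Ioi_zero_indicator_cpow {s : ℂ} (hs : 0 < s.re) (t : ℝ) :
    IntegrableOn ((Set.Iio t).indicator (fun x : ℝ => (x : ℂ) ^ (s - 1))) (Set.Ioi 0) := by
  rw [IntegrableOn, integrable_indicator_iff measurableSet_Iio, IntegrableOn,
    Measure.restrict_restrict measurableSet_Iio]
  rcases le_total t 0 with ht | ht
  · rw [Set.inter_comm, Set.Ioi_inter_Iio, Set.Ioo_eq_empty (by linarith)]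
    simp
  · have := (intervalIntegrable_iff_integrableOn_Ioo_of_le ht).1
      (intervalIntegral.intervalIntegrable_cpow' (a := 0) (b := t) (r := s - 1) (by simpa using hs))
    rwa [Set.inter_comm, Set.Ioi_inter_Iio]

section
variable {μ : Measure ℝ} [IsProbabilityMeasure μ] {s : ℂ}

theorem integrable_prod_indicator_cpow (hμ : ∀ᵐ t ∂μ, 0 < t) (hs : 0 < s.re)
    (hint : Integrable (fun t => t ^ s.re) μ) :
    Integrable (Function.uncurry fun x t : ℝ =>
      (Set.Iio t).indicator (fun x : ℝ => (x : ℂ) ^ (s - 1)) x)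
      ((volume.restrict (Set.Ioi 0)).prod μ) := by
  have hmeas : Measurable (Function.uncurry fun x t : ℝ =>
      (Set.Iio t).indicator (fun x : ℝ => (x : ℂ) ^ (s - 1)) x) := by
    have : (Function.uncurry fun x t : ℝ =>
        (Set.Iio t).indicator (fun x : ℝ => (x : ℂ) ^ (s - 1)) x) =
        {p : ℝ × ℝ | p.1 < p.2}.indicator fun p => (p.1 : ℂ) ^ (s - 1) := by
      ext ⟨x, t⟩
      simp [Set.indicator]
    rw [this]
    exact Measurable.indicator (by fun_prop) (measurableSet_lt measurable_fst measurable_snd)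
  rw [integrable_prod_iff' hmeas.aestronglyMeasurable]
  refine ⟨.of_forall fun t => integrableOn_Ioi_zero_indicator_cpow hs t, ?_⟩
  refine (hint.div_const s.re).congr ?_
  filter_upwards [hμ] with t ht
  have h := integral_Ioi_zero_indicator_cpow (s := (s.re : ℂ)) (by simpa using hs) ht
  rw [← Complex.ofReal_cpow ht.le, ← Complex.ofReal_div] at h
  rw [← Complex.ofReal_inj, ← h, ← integral_complex_ofReal]
  refine setIntegral_congr_fun measurableSet_Ioi fun x hx => ?_
  have hx0 : 0 < x := hx
  by_cases hxt : x < t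
  · simp only [Function.uncurry, Set.indicator, Set.mem_Iio, hxt, if_true]
    rw [Complex.norm_cpow_eq_rpow_re_of_pos hx0, Complex.ofReal_cpow hx0.le]
    simp
  · simp [Set.indicator, hxt]

theorem cpow_smul_measureReal_Ioi (μ : Measure ℝ) [IsProbabilityMeasure μ] (s : ℂ) (x : ℝ) :
    (x : ℂ) ^ (s - 1) • (μ.real (Set.Ioi x) : ℂ) =
      ∫ t, (Set.Iio t).indicator (fun x : ℝ => (x : ℂ) ^ (s - 1)) x ∂μ := by
  have : (fun t => (Set.Iio t).indicator (fun x : ℝ => (x : ℂ) ^ (s - 1)) x) =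
      (Set.Ioi x).indicator fun _ => (x : ℂ) ^ (s - 1) := by
    ext t
    simp [Set.indicator]
  rw [this, integral_indicator measurableSet_Ioi, setIntegral_const, Complex.real_smul, smul_eq_mul,
    mul_comm]

/-- The Mellin transform of the tail of a law on the positive reals converges. -/
theorem mellinConvergent_measureReal_Ioi (hμ : ∀ᵐ t ∂μ, 0 < t) (hs : 0 < s.re)
    (hint : Integrable (fun t => t ^ s.re) μ) :
    MellinConvergent (fun x => (μ.real (Set.Ioi x) : ℂ)) s := by
  rw [MellinConvergent]
  simp_rw [cpow_smul_measureReal_Ioi]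
  exact (integrable_prod_indicator_cpow hμ hs hint).integral_prod_left

/-- The Mellin transform of the tail of a law on the positive reals, in terms of its moments. -/
theorem mellin_measureReal_Ioi (hμ : ∀ᵐ t ∂μ, 0 < t) (hs : 0 < s.re)
    (hint : Integrable (fun t => t ^ s.re) μ) :
    mellin (fun x => (μ.real (Set.Ioi x) : ℂ)) s = (∫ t, (t : ℂ) ^ s ∂μ) / s := by
  rw [mellin]
  simp_rw [cpow_smul_measureReal_Ioi]
  rw [integral_integral_swap (integrable_prod_indicator_cpow hμ hs hint), ← integral_div]
  refine integral_congr_ae ?_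
  filter_upwards [hμ] with t ht using integral_Ioi_zero_indicator_cpow hs ht

end

section
variable {A : ℝ}

theorem upperGamma_one_add (hA : 0 < A) (s : ℂ) :
    upperGamma (1 + s) A = ∫ t in Set.Ioi A, (t : ℂ) ^ s * (Real.exp (-t) : ℂ) := by
  rw [upperGamma, if_neg hA.ne', add_sub_cancel_left]

theorem integrableOn_cpow_mul_exp_neg (hA : 0 < A) {s : ℂ} (hs : 0 < s.re) :
    IntegrableOn (fun t : ℝ => (t : ℂ) ^ s * (Real.exp (-t) : ℂ)) (Set.Ioi A) := by
  refine Integrable.mono' (integrableOn_rpow_mul_exp_neg hA hs)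
    (Measurable.aestronglyMeasurable (by fun_prop)) ?_
  filter_upwards [ae_restrict_mem measurableSet_Ioi] with t ht
  rw [norm_mul, Complex.norm_cpow_eq_rpow_re_of_pos (hA.trans ht), Complex.norm_real,
    Real.norm_of_nonneg (Real.exp_pos _).le]

theorem norm_upperGamma_one_add_le (hA : 0 < A) {s : ℂ} (hs : 0 < s.re) :
    ‖upperGamma (1 + s) A‖ ≤ ∫ t in Set.Ioi A, t ^ s.re * Real.exp (-t) := by
  rw [upperGamma_one_add hA]
  refine norm_integral_le_of_norm_le (integrableOn_rpow_mul_exp_neg hA hs) ?_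
  filter_upwards [ae_restrict_mem measurableSet_Ioi] with t ht
  rw [norm_mul, Complex.norm_cpow_eq_rpow_re_of_pos (hA.trans ht), Complex.norm_real,
    Real.norm_of_nonneg (Real.exp_pos _).le]

/-- The recurrence `Γ(s + 2, A) = (s + 1) Γ(s + 1, A) + A ^ (s + 1) e ^ (-A)`. -/
theorem upperGamma_recurrence (hA : 0 < A) {s : ℂ} (hs : 0 < s.re) :
    upperGamma (1 + (s + 1)) A =
      (s + 1) * upperGamma (1 + s) A + (A : ℂ) ^ (s + 1) * (Real.exp (-A) : ℂ) := by
  have hs1 : 0 < (s + 1).re := by simp; linarith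
  have hi1 := integrableOn_cpow_mul_exp_neg hA hs
  have hi2 := integrableOn_cpow_mul_exp_neg hA hs1
  have hderiv : ∀ t ∈ Set.Ici A, HasDerivAt
      (fun t : ℝ => (t : ℂ) ^ (s + 1) * (Real.exp (-t) : ℂ))
      ((s + 1) * ((t : ℂ) ^ s * (Real.exp (-t) : ℂ)) -
        (t : ℂ) ^ (s + 1) * (Real.exp (-t) : ℂ)) t := by
    intro t ht
    have ht0 : t ≠ 0 := (hA.trans_le ht).ne'
    have hs0 : s + 1 ≠ 0 := by intro h; rw [h] at hs1; simp at hs1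
    have h1 : HasDerivAt (fun t : ℝ => (t : ℂ) ^ (s + 1)) ((s + 1) * (t : ℂ) ^ s) t := by
      have := hasDerivAt_ofReal_cpow_const' ht0 (r := s) (by
        intro h; rw [h] at hs; norm_num at hs)
      have h2 := this.const_mul (s + 1)
      refine h2.congr_of_eventuallyEq (.of_forall fun y => ?_)
      field_simp
    have h2 : HasDerivAt (fun t : ℝ => (Real.exp (-t) : ℂ)) (-(Real.exp (-t) : ℂ)) t := by
      have := ((hasDerivAt_neg t).exp).ofReal_comp
      simpa using this
    refine (h1.mul h2).congr_deriv ?_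
    ring
  have hlim : Filter.Tendsto (fun t : ℝ => (t : ℂ) ^ (s + 1) * (Real.exp (-t) : ℂ))
      Filter.atTop (nhds 0) := by
    rw [tendsto_zero_iff_norm_tendsto_zero]
    refine (tendsto_rpow_mul_exp_neg_mul_atTop_nhds_zero (s + 1).re 1 one_pos).congr' ?_
    filter_upwards [Filter.eventually_gt_atTop 0] with t ht
    rw [norm_mul, Complex.norm_cpow_eq_rpow_re_of_pos ht, Complex.norm_real,
      Real.norm_of_nonneg (Real.exp_pos _).le]
    simp
  have h := integral_Ioi_of_hasDerivAt_of_tendsto' hderiv ((hi1.const_mul _).sub hi2) hlim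
  rw [integral_sub (hi1.const_mul _) hi2, integral_const_mul, ← upperGamma_one_add hA,
    ← upperGamma_one_add hA] at h
  linear_combination -h

/-- On a vertical line in the right half plane, `Γ(1 + s, A)` is bounded and `O(1 / |s|)`. -/
theorem exists_norm_upperGamma_le (hA : 0 < A) {c : ℝ} (hc : 0 < c) :
    ∃ C : ℝ, 0 < C ∧ ∀ s : ℂ, s.re = c →
      ‖upperGamma (1 + s) A‖ ≤ C ∧ ‖upperGamma (1 + s) A‖ ≤ C / ‖s‖ := by
  set I : ℝ → ℝ := fun c => ∫ t in Set.Ioi A, t ^ c * Real.exp (-t) with hI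
  have hI0 : ∀ c, 0 ≤ I c := fun c => setIntegral_nonneg measurableSet_Ioi fun t ht =>
    mul_nonneg (Real.rpow_nonneg (hA.trans ht).le _) (Real.exp_pos _).le
  set B : ℝ := A ^ (c + 1) * Real.exp (-A) with hB
  have hB0 : 0 < B := by positivity
  refine ⟨I c + (I (c + 1) + B), by linarith [hI0 c, hI0 (c + 1)], fun s hs => ⟨?_, ?_⟩⟩
  · have := norm_upperGamma_one_add_le hA (s := s) (by rw [hs]; exact hc)
    rw [hs] at this
    linarith [hI0 (c + 1)]
  · have hsn : 0 < ‖s‖ := by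
      refine norm_pos_iff.2 ?_
      rintro rfl
      simp at hs
      linarith
    have h1 := norm_upperGamma_one_add_le hA (s := s + 1) (by simp [hs]; linarith)
    have hre : (s + 1).re = c + 1 := by simp [hs]
    rw [hre] at h1
    have h2 := upperGamma_recurrence hA (s := s) (by rw [hs]; exact hc)
    have h3 : (s + 1) * upperGamma (1 + s) A =
        upperGamma (1 + (s + 1)) A - (A : ℂ) ^ (s + 1) * (Real.exp (-A) : ℂ) := by
      rw [h2]; ring
    have h4 : ‖s + 1‖ * ‖upperGamma (1 + s) A‖ ≤ I (c + 1) + B := by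
      rw [← norm_mul, h3]
      refine (norm_sub_le _ _).trans (add_le_add h1 (le_of_eq ?_))
      rw [norm_mul, Complex.norm_cpow_eq_rpow_re_of_pos hA, Complex.norm_real,
        Real.norm_of_nonneg (Real.exp_pos _).le, hre]
    have h5 : ‖s‖ ≤ ‖s + 1‖ := by
      rw [Complex.norm_def, Complex.norm_def]
      refine Real.sqrt_le_sqrt ?_
      rw [Complex.normSq_apply, Complex.normSq_apply]
      simp only [Complex.add_re, Complex.add_im, Complex.one_re, Complex.one_im, hs]
      nlinarith
    rw [le_div_iff₀ hsn]
    nlinarith [norm_nonneg (upperGamma (1 + s) A), hI0 c]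

theorem measurable_upperGamma_vertical (hA : 0 < A) (c : ℝ) :
    Measurable fun y : ℝ => upperGamma (1 + (c + y * Complex.I)) A := by
  simp_rw [upperGamma_one_add hA]
  have : StronglyMeasurable (Function.uncurry fun y t : ℝ =>
      (t : ℂ) ^ ((c : ℂ) + y * Complex.I) * (Real.exp (-t) : ℂ)) :=
    Measurable.stronglyMeasurable (by unfold Function.uncurry; fun_prop)
  exact this.integral_prod_right.measurable

theorem verticalIntegrable_upperGamma_pow_div (hA : 0 < A) {c : ℝ} (hc : 0 < c) {K : ℕ}
    (hK : 1 ≤ K) : Complex.VerticalIntegrable (fun s => upperGamma (1 + s) A ^ K / s) c := by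
  obtain ⟨C, hC, hbound⟩ := exists_norm_upperGamma_le hA hc
  have hd : 0 < min (c ^ 2) 1 := by positivity
  refine Integrable.mono' (integrable_inv_one_add_sq.const_mul (C ^ K / min (c ^ 2) 1))
    (Measurable.aestronglyMeasurable
      (((measurable_upperGamma_vertical hA c).pow_const K).div (by fun_prop))) (.of_forall ?_)
  intro y
  obtain ⟨k, rfl⟩ : ∃ k, K = k + 1 := ⟨K - 1, by omega⟩
  set s : ℂ := c + y * Complex.I with hs
  have hre : s.re = c := by simp [hs]
  obtain ⟨h1, h2⟩ := hbound s hre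
  have hsq : ‖s‖ ^ 2 = c ^ 2 + y ^ 2 := by
    rw [← Complex.normSq_eq_norm_sq, Complex.normSq_apply]
    simp [hs, pow_two]
  have hs0 : 0 < ‖s‖ := by
    refine norm_pos_iff.2 fun h => ?_
    rw [h] at hre
    simp at hre
    linarith
  calc ‖upperGamma (1 + s) A ^ (k + 1) / s‖
      = ‖upperGamma (1 + s) A‖ ^ k * ‖upperGamma (1 + s) A‖ / ‖s‖ := by
        rw [norm_div, norm_pow, pow_succ]
    _ ≤ C ^ k * (C / ‖s‖) / ‖s‖ := by gcongr
    _ = C ^ (k + 1) / ‖s‖ ^ 2 := by rw [pow_succ]; field_simp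
    _ ≤ C ^ (k + 1) / (min (c ^ 2) 1 * (1 + y ^ 2)) := by
        rw [hsq]
        gcongr
        nlinarith [min_le_left (c ^ 2) 1, min_le_right (c ^ 2) 1, sq_nonneg y]
    _ = C ^ (k + 1) / min (c ^ 2) 1 * (1 + y ^ 2)⁻¹ := by rw [div_mul_eq_div_div]; rfl

end

theorem ofReal_prod_cpow {ι : Type*} (S : Finset ι) {f : ι → ℝ} (hf : ∀ i ∈ S, 0 ≤ f i) (s : ℂ) :
    ((∏ i ∈ S, f i : ℝ) : ℂ) ^ s = ∏ i ∈ S, (f i : ℂ) ^ s := by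
  classical
  induction S using Finset.induction_on with
  | empty => simp
  | insert a S ha ih =>
    have hS : ∀ i ∈ S, 0 ≤ f i := fun i hi => hf i (Finset.mem_insert_of_mem hi)
    rw [Finset.prod_insert ha, Finset.prod_insert ha, Complex.ofReal_mul,
      Complex.mul_cpow_ofReal_nonneg (hf a (Finset.mem_insert_self a S)) (Finset.prod_nonneg hS),
      ih hS]

section
variable {Ω : Type*} [MeasurableSpace Ω] {P : Measure Ω} {K : ℕ} {A : ℝ} {Y : Fin K → Ω → ℝ}

theorem ae_forall_pos_of_shiftedExp (hA : 0 < A) (hlaw : ∀ k, HasLaw (Y k) (shiftedExp A) P) :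
    ∀ᵐ ω ∂P, ∀ k, 0 < Y k ω := by
  rw [ae_all_iff]
  intro k
  have h := ae_lt_shiftedExp A
  rw [← (hlaw k).map_eq] at h
  filter_upwards [ae_of_ae_map (hlaw k).aemeasurable h] with ω hω using hA.trans hω

theorem integral_prod_cpow_of_shiftedExp (hA : 0 < A) (hindep : iIndepFun Y P)
    (hlaw : ∀ k, HasLaw (Y k) (shiftedExp A) P) (s : ℂ) :
    ∫ ω, ((∏ k, Y k ω : ℝ) : ℂ) ^ s ∂P = (Real.exp (K * A) : ℂ) * upperGamma (1 + s) A ^ K := by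
  have hm : Measurable fun t : ℝ => (t : ℂ) ^ s := by fun_prop
  calc ∫ ω, ((∏ k, Y k ω : ℝ) : ℂ) ^ s ∂P
      = ∫ ω, ∏ k, (Y k ω : ℂ) ^ s ∂P := by
        refine integral_congr_ae ?_
        filter_upwards [ae_forall_pos_of_shiftedExp hA hlaw] with ω hω
        exact ofReal_prod_cpow _ (fun k _ => (hω k).le) s
    _ = ∏ k, ∫ ω, (Y k ω : ℂ) ^ s ∂P :=
        hindep.integral_fun_prod_comp (X := Y) (fun k => (hlaw k).aemeasurable)
          (f := fun _ (t : ℝ) => (t : ℂ) ^ s) fun _ => hm.aestronglyMeasurable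
    _ = ∏ _k : Fin K, ((Real.exp A : ℂ) * upperGamma (1 + s) A) := by
        refine Finset.prod_congr rfl fun k _ => ?_
        rw [← integral_cpow_shiftedExp hA]
        exact (hlaw k).integral_comp hm.aestronglyMeasurable
    _ = (Real.exp (K * A) : ℂ) * upperGamma (1 + s) A ^ K := by
        rw [Finset.prod_const, Finset.card_univ, Fintype.card_fin, mul_pow, Real.exp_nat_mul,
          Complex.ofReal_pow]

variable [IsProbabilityMeasure P]

theorem measure_mul_eq_zero_of_indepFun {X Y : Ω → ℝ} (hX : AEMeasurable X P)
    (hY : AEMeasurable Y P) (hXY : IndepFun X Y P) (hX0 : ∀ᵐ ω ∂P, X ω ≠ 0)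
    [NullSingletonClass (P.map Y)] (x : ℝ) : P {ω | X ω * Y ω = x} = 0 := by
  have hmeas : MeasurableSet {p : ℝ × ℝ | p.1 * p.2 = x} :=
    measurableSet_eq_fun (by fun_prop) (by fun_prop)
  have h1 : P {ω | X ω * Y ω = x} = P.map (fun ω => (X ω, Y ω)) {p : ℝ × ℝ | p.1 * p.2 = x} := by
    rw [Measure.map_apply_of_aemeasurable (hX.prodMk hY) hmeas]
    rfl
  rw [h1, (indepFun_iff_map_prod_eq_prod_map_map hX hY).1 hXY, Measure.measure_prod_null hmeas]
  have h2 : ∀ᵐ w ∂P.map X, w ≠ 0 :=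
    (ae_map_iff hX (measurableSet_singleton (0 : ℝ)).compl).2 hX0
  filter_upwards [h2] with w hw
  refine measure_mono_null (t := {x / w}) (fun y hy => ?_) (measure_singleton _)
  have hy' : w * y = x := hy
  rw [Set.mem_singleton_iff, eq_div_iff hw, mul_comm, hy']

theorem measure_prod_eq_zero_of_shiftedExp (hK : 1 ≤ K) (hA : 0 < A) (hindep : iIndepFun Y P)
    (hlaw : ∀ k, HasLaw (Y k) (shiftedExp A) P) (x : ℝ) : P {ω | ∏ k, Y k ω = x} = 0 := by
  let i : Fin K := ⟨0, hK⟩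
  have : NullSingletonClass (P.map (Y i)) := by rw [(hlaw i).map_eq]; infer_instance
  have h := measure_mul_eq_zero_of_indepFun (P := P) (X := ∏ k ∈ Finset.univ.erase i, Y k)
    (Finset.aemeasurable_prod _ fun k _ => (hlaw k).aemeasurable) (hlaw i).aemeasurable
    (hindep.indepFun_finsetProd_of_notMem₀ (fun k => (hlaw k).aemeasurable)
      (Finset.notMem_erase i _))
    (by
      filter_upwards [ae_forall_pos_of_shiftedExp hA hlaw] with ω hω
      rw [Finset.prod_apply]
      exact Finset.prod_ne_zero_iff.2 fun k _ => (hω k).ne') x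
  simp only [Finset.prod_apply] at h
  simpa only [Finset.prod_erase_mul _ _ (Finset.mem_univ i)] using h

theorem integrable_prod_rpow_of_shiftedExp (hA : 0 < A) (hindep : iIndepFun Y P)
    (hlaw : ∀ k, HasLaw (Y k) (shiftedExp A) P) {c : ℝ} (hc : 0 < c) :
    Integrable (fun ω => (∏ k, Y k ω) ^ c) P := by
  have hae : ∀ k, AEMeasurable (Y k) P := fun k => (hlaw k).aemeasurable
  have hp : ∀ k, IsProbabilityMeasure (P.map (Y k)) := fun k =>
    Measure.isProbabilityMeasure_map (hae k)
  have h1 : Integrable (fun y : Fin K → ℝ => ∏ k, y k ^ c) (P.map fun ω k => Y k ω) := by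
    rw [hindep.map_fun_eq_pi_map hae]
    refine Integrable.fintype_prod (f := fun _ y => y ^ c) fun k => ?_
    rw [(hlaw k).map_eq]
    exact integrable_rpow_shiftedExp hA hc
  refine (h1.comp_aemeasurable (aemeasurable_pi_lambda _ hae)).congr ?_
  filter_upwards [ae_forall_pos_of_shiftedExp hA hlaw] with ω hω
  exact Real.finsetProd_rpow _ _ (fun k _ => (hω k).le) c

/-- The tail of a product of independent shifted exponential variables as an inverse Mellin
transform. -/
theorem measureReal_lt_prod_eq_mellinInv (hK : 1 ≤ K) (hA : 0 < A) (hindep : iIndepFun Y P)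
    (hlaw : ∀ k, HasLaw (Y k) (shiftedExp A) P) {c : ℝ} (hc : 0 < c) {x : ℝ} (hx : 0 < x) :
    (P.real {ω | x < ∏ k, Y k ω} : ℂ) =
      (Real.exp (K * A) : ℂ) * mellinInv c (fun s => upperGamma (1 + s) A ^ K / s) x := by
  have hZ : AEMeasurable (fun ω => ∏ k, Y k ω) P :=
    Finset.aemeasurable_fun_prod _ fun k _ => (hlaw k).aemeasurable
  set μ := P.map fun ω => ∏ k, Y k ω with hμdef
  have hprob : IsProbabilityMeasure μ := Measure.isProbabilityMeasure_map hZ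
  have hpos : ∀ᵐ t ∂μ, 0 < t := by
    rw [hμdef, ae_map_iff hZ measurableSet_Ioi]
    filter_upwards [ae_forall_pos_of_shiftedExp hA hlaw] with ω hω
    exact Finset.prod_pos fun k _ => hω k
  have hint : Integrable (fun t => t ^ c) μ :=
    (integrable_map_measure (Measurable.aestronglyMeasurable (by fun_prop)) hZ).2
      (integrable_prod_rpow_of_shiftedExp hA hindep hlaw hc)
  have hmellin : ∀ y : ℝ, mellin (fun x => (μ.real (Set.Ioi x) : ℂ)) (c + y * Complex.I) =
      (Real.exp (K * A) : ℂ) *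
        (upperGamma (1 + (c + y * Complex.I)) A ^ K / (c + y * Complex.I)) := by
    intro y
    rw [mellin_measureReal_Ioi hpos (by simpa using hc) (by simpa using hint), hμdef,
      integral_map hZ (Measurable.aestronglyMeasurable (by fun_prop)),
      integral_prod_cpow_of_shiftedExp hA hindep hlaw, mul_div_assoc]
  have hsing : μ {x} = 0 := by
    rw [hμdef, Measure.map_apply_of_aemeasurable hZ (measurableSet_singleton x)]
    exact measure_prod_eq_zero_of_shiftedExp hK hA hindep hlaw x
  have hinv := mellinInv_mellin_eq c (fun x => (μ.real (Set.Ioi x) : ℂ)) hx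
    (mellinConvergent_measureReal_Ioi hpos (by simpa using hc) (by simpa using hint))
    (by
      refine ((verticalIntegrable_upperGamma_pow_div hA hc hK).const_mul
        (Real.exp (K * A) : ℂ)).congr (.of_forall fun y => ?_)
      exact (hmellin y).symm)
    (Complex.continuous_ofReal.continuousAt.comp (continuousAt_measureReal_Ioi μ hsing))
  have hreal : P.real {ω | x < ∏ k, Y k ω} = μ.real (Set.Ioi x) := by
    rw [hμdef, map_measureReal_apply_of_aemeasurable hZ measurableSet_Ioi]
    rfl
  rw [hreal, ← hinv, mellinInv, mellinInv]
  simp_rw [hmellin, smul_eq_mul, mul_left_comm _ (Real.exp (K * A) : ℂ)]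
  rw [integral_const_mul, Complex.real_smul, Complex.real_smul, mul_left_comm]

theorem measureReal_prod_lt_eq (hK : 1 ≤ K) (hA : 0 < A) (hindep : iIndepFun Y P)
    (hlaw : ∀ k, HasLaw (Y k) (shiftedExp A) P) (x : ℝ) :
    P.real {ω | ∏ k, Y k ω < x} = 1 - P.real {ω | x < ∏ k, Y k ω} := by
  have hZ : AEMeasurable (fun ω => ∏ k, Y k ω) P :=
    Finset.aemeasurable_fun_prod _ fun k _ => (hlaw k).aemeasurable
  have hnull : NullMeasurableSet {ω | x < ∏ k, Y k ω} P :=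
    nullMeasurableSet_lt aemeasurable_const hZ
  rw [← probReal_compl_eq_one_sub₀ hnull]
  refine measureReal_congr ?_
  have h0 : ∀ᵐ ω ∂P, ∏ k, Y k ω ≠ x :=
    ae_iff.2 (by simpa using measure_prod_eq_zero_of_shiftedExp hK hA hindep hlaw x)
  filter_upwards [h0] with ω hω
  exact propext ⟨fun h => not_lt.2 (le_of_lt h), fun h => lt_of_le_of_ne (not_lt.1 h) hω⟩

end

theorem mutualInfo_scalar {K : ℕ} (ρ : ℝ) (z : Fin K → ℂ) :
    mutualInfo ρ (fun k => (Matrix.of fun _ _ => z k : Matrix (Fin 1) (Fin 1) ℂ)) =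
      (1 / (K : ℝ)) * ∑ k, Real.logb 2 (1 + ρ * ‖z k‖ ^ 2) := by
  rw [mutualInfo]
  congr 1
  refine Finset.sum_congr rfl fun k _ => ?_
  congr 1
  rw [Matrix.det_fin_one]
  simp [Matrix.mul_apply, Complex.mul_conj, Complex.normSq_eq_norm_sq, -Complex.ofReal_pow]

theorem mutualInfo_scalar_lt_iff {K m : ℕ} (hK : 1 ≤ K) (hm : 1 ≤ m) {ρ : ℝ} (hρ : 0 < ρ) (R : ℝ)
    (z : Fin K → ℂ) :
    mutualInfo ρ (fun k => (Matrix.of fun _ _ => z k : Matrix (Fin 1) (Fin 1) ℂ)) < R ↔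
      ∏ k, (1 / (ρ * m) + ‖z k‖ ^ 2 / m) < (2 ^ R / (ρ * m)) ^ K := by
  have hm0 : (0 : ℝ) < m := by exact_mod_cast hm
  have hK0 : (0 : ℝ) < K := by exact_mod_cast hK
  have hpos : ∀ k, 0 < 1 + ρ * ‖z k‖ ^ 2 := fun k => by positivity
  have hprod : ∏ k, (1 / (ρ * m) + ‖z k‖ ^ 2 / m) =
      (∏ k, (1 + ρ * ‖z k‖ ^ 2)) / (ρ * m) ^ K := by
    have : ∀ k, 1 / (ρ * m) + ‖z k‖ ^ 2 / m = (1 + ρ * ‖z k‖ ^ 2) / (ρ * m) := fun k => by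
      field_simp
    simp_rw [this]
    rw [Finset.prod_div_distrib]
    simp
  rw [mutualInfo_scalar, hprod, div_pow, div_lt_div_iff_of_pos_right (by positivity),
    ← Real.rpow_mul_natCast zero_le_two, ← Real.logb_lt_iff_lt_rpow one_lt_two
      (Finset.prod_pos fun k _ => hpos k), Real.logb_prod _ _ fun k _ => (hpos k).ne',
    one_div, inv_mul_lt_iff₀ hK0, mul_comm R]

theorem foxKernel_outage (K : ℕ) (A : ℝ) {s : ℂ} (hs : 0 < s.re) :
    foxKernel (K + 1) 0 outageUpper (outageLower K A) s = upperGamma (1 + s) A ^ K / s := by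
  have hs0 : s ≠ 0 := by rintro rfl; simp at hs
  have hG : Complex.Gamma s ≠ 0 := Complex.Gamma_ne_zero_of_re_pos hs
  have h1 : Complex.Gamma (1 + s) = s * Complex.Gamma s := by
    rw [add_comm, Complex.Gamma_add_one _ hs0]
  have hz : ∀ s, upperGamma s 0 = Complex.Gamma s := fun s => if_pos rfl
  simp only [foxKernel, Fin.is_lt, if_true, Fin.prod_univ_succ, outageLower, outageUpper,
    Fin.cons_zero, Fin.cons_succ, Finset.prod_const, Finset.card_univ, Fintype.card_fin]
  simp [hz, h1]
  field_simp

theorem isFoxContour_outage_iff (K : ℕ) {A : ℝ} (hA : 0 < A) (c : ℝ) :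
    IsFoxContour (K + 1) 0 outageUpper (outageLower K A) c ↔ 0 < c := by
  constructor
  · intro h
    simpa using h.1 0 (Nat.succ_pos K) (by simp [outageLower]) 0 0 (by simp [outageLower])
  · refine fun hc => ⟨fun j => ?_, fun i hi => absurd hi (Nat.not_lt_zero _)⟩
    refine Fin.cases (fun _ _ l s hs => ?_) (fun j _ h0 => ?_) j
    · have hs' : s = -(l : ℂ) := by simpa [outageLower] using hs
      rw [hs']
      simp only [Complex.neg_re, Complex.natCast_re]
      linarith [Nat.cast_nonneg (α := ℝ) l]
    · exact absurd h0 (by simpa [outageLower] using hA.ne')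
theorem theorem1 {Ω : Type*} [MeasurableSpace Ω] (P : Measure Ω) [IsProbabilityMeasure P]
    (K m : ℕ) (hK : 1 ≤ K) (hm : 1 ≤ m) (ρ R : ℝ) (hρ : 0 < ρ) (hR : 0 ≤ R)
    (h : Fin K → Ω → ℂ) (h_indep : iIndepFun h P)
    (h_law : ∀ k, HasLaw (h k) (complexGaussian (m : ℝ≥0)) P) :
    (∃ c : ℝ, IsFoxContour (K + 1) 0 outageUpper (outageLower K (1 / (ρ * m))) c) ∧
    ∀ c : ℝ, IsFoxContour (K + 1) 0 outageUpper (outageLower K (1 / (ρ * m))) c →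
      Complex.VerticalIntegrable
        (fun s : ℂ => (((2 ^ R / (ρ * m)) ^ K : ℝ) : ℂ) ^ (-s) *
          foxKernel (K + 1) 0 outageUpper (outageLower K (1 / (ρ * m))) s) c ∧
      (outageProb P ρ R
          (fun k ω => (Matrix.of fun _ _ => h k ω : Matrix (Fin 1) (Fin 1) ℂ)) : ℂ) =
        1 - (Real.exp (K / (ρ * m)) : ℂ) *
          upperIncFoxH (K + 1) 0 outageUpper (outageLower K (1 / (ρ * m))) c
            ((2 ^ R / (ρ * m)) ^ K) := by
  have hm0 : (0 : ℝ) < m := by exact_mod_cast hm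
  have hA : 0 < 1 / (ρ * m) := by positivity
  have hΘ : 0 < (2 ^ R / (ρ * m)) ^ K := by positivity
  refine ⟨⟨1, (isFoxContour_outage_iff K hA 1).2 one_pos⟩, fun c hc => ?_⟩
  have hc0 : 0 < c := (isFoxContour_outage_iff K hA c).1 hc
  have hkernel : ∀ y : ℝ,
      foxKernel (K + 1) 0 outageUpper (outageLower K (1 / (ρ * m))) (c + y * Complex.I) =
        upperGamma (1 + (c + y * Complex.I)) (1 / (ρ * m)) ^ K / (c + y * Complex.I) :=
    fun y => foxKernel_outage K _ (by simpa using hc0)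
  refine ⟨?_, ?_⟩
  · refine ((verticalIntegrable_upperGamma_pow_div hA hc0 hK).bdd_mul
      (f := fun y : ℝ => (((2 ^ R / (ρ * m)) ^ K : ℝ) : ℂ) ^ (-(c + y * Complex.I)))
      (c := ((2 ^ R / (ρ * m)) ^ K) ^ (-c))
      (Measurable.aestronglyMeasurable (by fun_prop)) (.of_forall fun y => ?_)).congr
        (.of_forall fun y => ?_)
    · rw [Complex.norm_cpow_eq_rpow_re_of_pos hΘ]
      simp
    · simp only [hkernel]
  · have hg : Measurable fun z : ℂ => 1 / (ρ * m) + ‖z‖ ^ 2 / m := by fun_prop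
    have hlaw : ∀ k, HasLaw (fun ω => 1 / (ρ * m) + ‖h k ω‖ ^ 2 / m)
        (shiftedExp (1 / (ρ * m))) P := fun k => by
      have hlaw_comp := HasLaw.comp (Y := fun z : ℂ => 1 / (ρ * m) + ‖z‖ ^ 2 / m)
        ⟨hg.aemeasurable, map_complexGaussian_add_norm_sq
          (v := (m : ℝ≥0)) (by exact_mod_cast hm0.ne') (1 / (ρ * m))⟩ (h_law k)
      exact hlaw_comp
    have hindep : iIndepFun (fun k ω => 1 / (ρ * m) + ‖h k ω‖ ^ 2 / m) P :=
      h_indep.comp (fun _ z => 1 / (ρ * m) + ‖z‖ ^ 2 / m) fun _ => hg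
    have hmellin : upperIncFoxH (K + 1) 0 outageUpper (outageLower K (1 / (ρ * m))) c
        ((2 ^ R / (ρ * m)) ^ K) =
        mellinInv c (fun s => upperGamma (1 + s) (1 / (ρ * m)) ^ K / s)
          ((2 ^ R / (ρ * m)) ^ K) := by
      rw [upperIncFoxH, mellinInv, mellinInv]
      simp_rw [hkernel]
    rw [hmellin, outageProb]
    simp_rw [mutualInfo_scalar_lt_iff hK hm hρ]
    rw [measureReal_prod_lt_eq hK hA hindep hlaw, Complex.ofReal_sub,
      measureReal_lt_prod_eq_mellinInv hK hA hindep hlaw hc0 hΘ, Complex.ofReal_one,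
      mul_one_div]
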